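/- All graphs are finite, simple and undirected, and logarithms are natural. For a graph $G$ let $|G|$ and $e(G)$ be its numbers of vertices and edges. A graph $H$ is a minor of $G$ if there are pairwise disjoint non-empty sets $V_h\subseteq V(G)$ $(h\in V(H))$, each inducing a connected subgraph of $G$, such that for every edge $hh'$ of $H$ there is an edge of $G$ between $V_h$ and $V_{h'}$. Let $c(H)=\inf\{c\in\mathbb{R}: \text{every graph } G \text{ with } |G|\geq 1 \text{ and } e(G)/|G|\geq c \text{ has } H \text{ as a minor}\}$, the infimum being taken in $[-\infty,+\infty]$. Let $$\alpha=\max_{0<p<1}\frac{p}{2\sqrt{\log(1/(1-p))}}=0.319\ldots$$ **Theorem.** For every $\epsilon>0$ there is a constant $T=T(\epsilon)$ such that for every integer $t\ge 0$ and every real $f$ with $T<f\leq\log t$, writing $s=\lfloor ft/\log t\rfloor$, there is a graph $G$ with at least one vertex such that $$\frac{e(G)}{|G|}\geq(2\alpha-\epsilon)\,t\sqrt{f}$$ and $G$ has no $K_{s,t}$ minor. In particular, $c(K_{s,t})\geq(2\alpha-\epsilon)\,t\sqrt{f}$. -/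

import Mathlib

/-- `H` is a minor of `G`: there is a model of `H` in `G`, that is, a family of pairwise disjoint
vertex sets of `G`, one for each vertex of `H`, each inducing a connected (in particular nonempty)
subgraph of `G`, such that for each edge `hh'` of `H` some edge of `G` joins the set of `h` to
the set of `h'`. -/
def IsGraphMinor {W V : Type*} (H : SimpleGraph W) (G : SimpleGraph V) : Prop :=
  ∃ B : W → Set V,
    (∀ h, (G.induce (B h)).Connected) ∧
    (∀ h h', h ≠ h' → Disjoint (B h) (B h')) ∧
    (∀ h h', H.Adj h h' → ∃ x ∈ B h, ∃ y ∈ B h', G.Adj x y)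

/-- The ratio `e(G)/|G|` of the number of edges to the number of vertices. -/
noncomputable def edgeRatio {V : Type*} (G : SimpleGraph V) : ℝ :=
  (G.edgeSet.ncard : ℝ) / (Nat.card V : ℝ)

/-- The minor extremal function: the infimum of the real numbers `c` such that every finite
graph `G` with at least one vertex and `e(G)/|G| ≥ c` has `H` as a minor. The infimum is taken
in the extended reals, so no value is assigned by convention in case there were no such `c`
(the infimum of the empty set is `⊤`). -/
noncomputable def minorExtremal {W : Type*} (H : SimpleGraph W) : EReal :=
  sInf (Real.toEReal '' {c : ℝ | ∀ n : ℕ, 0 < n → ∀ G : SimpleGraph (Fin n),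
    c ≤ edgeRatio G → IsGraphMinor H G})

/-- The constant `α = 0.319…`, the maximum over `0 < p < 1` of `p / (2 √(log (1 / (1 - p))))`. -/
noncomputable def minorAlpha : ℝ :=
  sSup ((fun p : ℝ => p / (2 * Real.sqrt (Real.log (1 / (1 - p))))) '' Set.Ioo 0 1)

/-! The graphs are random graphs `G(n, p)`. Write `q = 1 - p` and `λ = log (1 / q)`, choose `p` so
that `p / (2 √λ)` is nearly `minorAlpha`, and take `n` to be about `2 (1 - δ) t √(f / λ)` for a small
`δ > 0`. The expected ratio `e(G) / |G|` is then about `p n / 2`, which is nearly `2 * minorAlpha * t * √f`.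

A model of `K_{s,t}` in `G` is in particular a map from the vertices to `Option (Fin s ⊕ Fin t)`
such that each of the `s * t` pairs of parts on opposite sides is joined by an edge; connectedness
of the parts is not needed. For a fixed map with parts of sizes `a i` and `b j`, these events
concern disjoint sets of possible edges, so all of them hold with probability
`∏ (1 - q ^ (a i * b j)) ≤ exp (-∑ q ^ (a i * b j))`. As `∑ a i * b j = (∑ a i) * (∑ b j) ≤ n² / 4`, convexity bounds
this by `exp (-s t q ^ (n² / (4 s t)))` (`pi_real_partition_le`). Since `s` is about
`f t / log t`, the choice of `n` makes `q ^ (n² / (4 s t))` at least `t ^ (-(1 - δ))`, so the exponent is of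
order `f t ^ (1 + δ) / log t`, which beats the number `(s + t + 1) ^ n = exp (O (t √f log t))` of
maps (`pow_mul_exp_lt`). Hence a `K_{s,t}` minor is unlikely.

No concentration of the edge count is needed. If `G` has the minor with probability less than `η`,
the first moment of the number of edges restricted to the other graphs is at least
`(p - η) * n.choose 2`, so one of these graphs has that many edges (`exists_edgeSet_ncard_ge`).
-/

open MeasureTheory ProbabilityTheory

/-! ### Products of Bernoulli variables over disjoint blocks -/

/-- For independent bits `ω e`, each equal to `false` with probability `ν {false}`, the events that
a block of coordinates contains a `true` are independent over pairwise disjoint blocks. -/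
theorem pi_real_forall_exists_eq_true {ι κ : Type*} [Fintype ι]
    (ν : Measure Bool) [IsProbabilityMeasure ν] (S : κ → Finset ι)
    (K : Finset κ) (hS : (K : Set κ).PairwiseDisjoint S) :
    (Measure.pi fun _ : ι => ν).real {ω | ∀ k ∈ K, ∃ e ∈ S k, ω e = true} =
      ∏ k ∈ K, (1 - ν.real {false} ^ (S k).card) := by
  classical
  set μ : Measure (ι → Bool) := Measure.pi fun _ : ι => ν with hμ
  induction K using Finset.induction_on with
  | empty => simp
  | insert k K hk ih =>
    rw [Finset.coe_insert, Set.pairwiseDisjoint_insert] at hS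
    have hdisj : Disjoint (S k) (K.biUnion S) := by
      rw [Finset.disjoint_biUnion_right]
      intro j hj
      exact hS.2 j hj (by rintro rfl; exact hk hj)
    have hX : iIndepFun (fun (e : ι) (ω : ι → Bool) => ω e) μ :=
      iIndepFun_pi (X := fun _ b => b) fun _ => aemeasurable_id
    have hind := hX.indepFun_finset (S k) (K.biUnion S) hdisj fun e => measurable_pi_apply e
    have hhit : μ.real {ω | ∃ e ∈ S k, ω e = true} = 1 - ν.real {false} ^ (S k).card := by
      have hc : {ω : ι → Bool | ∃ e ∈ S k, ω e = true} =
          (Set.univ.pi fun e => if e ∈ S k then {false} else Set.univ)ᶜ := by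
        ext ω
        simp only [Set.mem_ofPred_eq, Set.mem_compl_iff, Set.mem_univ_pi, not_forall]
        refine exists_congr fun e => ?_
        by_cases he : e ∈ S k <;> simp [he]
      rw [hc, probReal_compl_eq_one_sub (Set.toFinite _).measurableSet]
      simp only [measureReal_def, hμ, Measure.pi_pi, ENNReal.toReal_prod]
      rw [← Finset.prod_subset (Finset.subset_univ (S k))
        (fun e _ he => by rw [if_neg he, measure_univ, ENNReal.toReal_one]), Finset.prod_congr rfl
        (fun e he => by rw [if_pos he]), Finset.prod_const]
    have hset := hind.measure_inter_preimage_eq_mul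
      {x | ∃ e, x e = true}
      {x | ∀ j, ∀ hj : j ∈ K, ∃ e, ∃ he : e ∈ S j,
        x ⟨e, Finset.mem_biUnion.2 ⟨j, hj, he⟩⟩ = true}
      (Set.toFinite _).measurableSet (Set.toFinite _).measurableSet
    have e1 : (fun (ω : ι → Bool) (e : S k) => ω e) ⁻¹' {x | ∃ e, x e = true} =
        {ω | ∃ e ∈ S k, ω e = true} := by
      ext ω; simp
    have e2 : (fun (ω : ι → Bool) (e : K.biUnion S) => ω e) ⁻¹'
        {x | ∀ j, ∀ hj : j ∈ K, ∃ e, ∃ he : e ∈ S j,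
          x ⟨e, Finset.mem_biUnion.2 ⟨j, hj, he⟩⟩ = true} =
        {ω | ∀ j ∈ K, ∃ e ∈ S j, ω e = true} := by
      ext ω; simp
    rw [e1, e2] at hset
    rw [Finset.prod_insert hk, ← ih hS.1, ← hhit, measureReal_def, measureReal_def,
      measureReal_def, ← ENNReal.toReal_mul, ← hset]
    congr 2
    ext ω
    simp

/-- Follows from `1 - x ≤ exp (-x)` and the inequality of the arithmetic and geometric means applied
to the numbers `q ^ m k`. -/
theorem prod_one_sub_pow_le_exp {κ : Type*} [Fintype κ] [Nonempty κ] {q : ℝ} (hq0 : 0 < q)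
    (hq1 : q ≤ 1) (m : κ → ℕ) {M : ℝ} (hM : ∑ k, (m k : ℝ) ≤ M) :
    ∏ k, (1 - q ^ m k) ≤ Real.exp (-(Fintype.card κ * q ^ (M / Fintype.card κ))) := by
  have hκ : (0 : ℝ) < Fintype.card κ := by exact_mod_cast Fintype.card_pos
  have h1 : ∏ k, (1 - q ^ m k) ≤ Real.exp (-∑ k, q ^ m k) := by
    rw [← Finset.sum_neg_distrib, Real.exp_sum]
    refine Finset.prod_le_prod (fun k _ => sub_nonneg.2 (pow_le_one₀ hq0.le hq1)) fun k _ => ?_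
    linarith [Real.add_one_le_exp (-q ^ m k)]
  refine h1.trans (Real.exp_le_exp.2 (neg_le_neg ?_))
  have h2 := Real.geom_mean_le_arith_mean_weighted Finset.univ
    (fun _ : κ => (Fintype.card κ : ℝ)⁻¹) (fun k => q ^ m k) (fun _ _ => by positivity)
    (by simp [hκ.ne']) (fun _ _ => by positivity)
  have h3 : ∏ k, (q ^ m k) ^ (Fintype.card κ : ℝ)⁻¹ =
      q ^ ((∑ k, (m k : ℝ)) / Fintype.card κ) := by
    rw [Finset.sum_div, Real.rpow_sum_of_pos hq0]
    refine Finset.prod_congr rfl fun k _ => ?_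
    rw [← Real.rpow_natCast, ← Real.rpow_mul hq0.le, div_eq_mul_inv]
  rw [h3, ← Finset.mul_sum, inv_mul_eq_div, le_div_iff₀' hκ] at h2
  refine le_trans (mul_le_mul_of_nonneg_left ?_ hκ.le) h2
  exact Real.rpow_le_rpow_of_exponent_ge hq0 hq1 (by gcongr)

/-! ### Random graphs and the union bound -/

/-- The graph whose edges are the non-diagonal pairs selected by `ω`. The values of `ω` on the
diagonal are ignored, so a product measure on all of `Sym2 V` induces the binomial random graph. -/
def graphOfIndicator {V : Type*} (ω : Sym2 V → Bool) : SimpleGraph V :=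
  SimpleGraph.fromEdgeSet {e | ω e = true}

/-- The pairs with one element in `A` and one in `B`. -/
def crossPairs {V : Type*} [DecidableEq V] (A B : Finset V) : Finset (Sym2 V) :=
  (A ×ˢ B).image fun x => s(x.1, x.2)

theorem mem_crossPairs {V : Type*} [DecidableEq V] {A B : Finset V} {x y : V} :
    s(x, y) ∈ crossPairs A B ↔ (x ∈ A ∧ y ∈ B) ∨ (y ∈ A ∧ x ∈ B) := by
  simp only [crossPairs, Finset.mem_image, Finset.mem_product, Prod.exists, Sym2.eq_iff]
  constructor
  · rintro ⟨a, b, ⟨ha, hb⟩, ⟨rfl, rfl⟩ | ⟨rfl, rfl⟩⟩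
    · exact Or.inl ⟨ha, hb⟩
    · exact Or.inr ⟨ha, hb⟩
  · rintro (⟨hx, hy⟩ | ⟨hy, hx⟩)
    · exact ⟨x, y, ⟨hx, hy⟩, by simp⟩
    · exact ⟨y, x, ⟨hy, hx⟩, by simp⟩

theorem card_crossPairs {V : Type*} [DecidableEq V] {A B : Finset V} (h : Disjoint A B) :
    (crossPairs A B).card = A.card * B.card := by
  rw [crossPairs, Finset.card_image_of_injOn, Finset.card_product]
  rintro ⟨a, b⟩ hab ⟨c, d⟩ hcd heq
  simp only [Finset.coe_product, Set.mem_prod, Finset.mem_coe] at hab hcd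
  rcases Sym2.eq_iff.1 heq with ⟨h1, h2⟩ | ⟨h1, h2⟩
  · exact Prod.ext h1 h2
  · dsimp only at h1 h2
    exact absurd (h1 ▸ hab.1) fun hc => Finset.disjoint_left.1 h hc hcd.2

/-- The part of index `h` in the partial partition encoded by `g`, where `none` marks the vertices
outside all parts. -/
def partOf {V W : Type*} [Fintype V] [DecidableEq W] (g : V → Option W) (h : W) : Finset V :=
  Finset.univ.filter fun v => g v = some h

theorem disjoint_partOf {V W : Type*} [Fintype V] [DecidableEq W] (g : V → Option W) {h h' : W}
    (hne : h ≠ h') : Disjoint (partOf g h) (partOf g h') := by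
  rw [Finset.disjoint_left]
  intro v hv hv'
  simp only [partOf, Finset.mem_filter, Finset.mem_univ, true_and] at hv hv'
  exact hne (Option.some.inj (hv.symm.trans hv'))

theorem sum_card_partOf_le {V W : Type*} [Fintype V] [DecidableEq W] [Fintype W]
    (g : V → Option W) : ∑ h, (partOf g h).card ≤ Fintype.card V := by
  classical
  rw [← Finset.card_biUnion fun h _ h' _ hne => disjoint_partOf g hne]
  exact Finset.card_le_univ _

/-- For a fixed family of disjoint parts, a bound on the probability that each of the `s * t` pairs
of parts on opposite sides is joined by an edge. -/
theorem pi_real_partition_le {V : Type*} [Fintype V] [DecidableEq V] {s t : ℕ} (hs : 0 < s)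
    (ht : 0 < t) (ν : Measure Bool) [IsProbabilityMeasure ν] (hν : 0 < ν.real {false})
    (g : V → Option (Fin s ⊕ Fin t)) :
    (Measure.pi fun _ : Sym2 V => ν).real {ω | ∀ k ∈ (Finset.univ : Finset (Fin s × Fin t)),
      ∃ e ∈ crossPairs (partOf g (Sum.inl k.1)) (partOf g (Sum.inr k.2)), ω e = true} ≤
    Real.exp (-(s * t * ν.real {false} ^ ((Fintype.card V : ℝ) ^ 2 / (4 * (s * t))))) := by
  have : Nonempty (Fin s) := ⟨⟨0, hs⟩⟩
  have : Nonempty (Fin t) := ⟨⟨0, ht⟩⟩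
  rw [pi_real_forall_exists_eq_true]
  · have hsum : ∑ k : Fin s × Fin t,
        ((crossPairs (partOf g (Sum.inl k.1)) (partOf g (Sum.inr k.2))).card : ℝ) ≤
        (Fintype.card V : ℝ) ^ 2 / 4 := by
      have h := sum_card_partOf_le g
      rw [Fintype.sum_sum_type] at h
      have h' : (∑ i, ((partOf g (Sum.inl i)).card : ℝ)) +
        ∑ j, ((partOf g (Sum.inr j)).card : ℝ) ≤ Fintype.card V := by exact_mod_cast h
      have h'' : ∑ k : Fin s × Fin t,
          ((crossPairs (partOf g (Sum.inl k.1)) (partOf g (Sum.inr k.2))).card : ℝ) =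
          (∑ i, ((partOf g (Sum.inl i)).card : ℝ)) *
            ∑ j, ((partOf g (Sum.inr j)).card : ℝ) := by
        rw [Finset.sum_mul_sum, ← Finset.univ_product_univ, Finset.sum_product]
        refine Finset.sum_congr rfl fun i _ => Finset.sum_congr rfl fun j _ => ?_
        rw [card_crossPairs (disjoint_partOf g Sum.inl_ne_inr), Nat.cast_mul]
      rw [h'']
      set a := ∑ i, ((partOf g (Sum.inl i)).card : ℝ)
      set b := ∑ j, ((partOf g (Sum.inr j)).card : ℝ)
      have ha : 0 ≤ a := Finset.sum_nonneg fun _ _ => Nat.cast_nonneg _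
      have hb : 0 ≤ b := Finset.sum_nonneg fun _ _ => Nat.cast_nonneg _
      clear_value a b
      -- `a * b ≤ ((a + b) / 2) ^ 2`
      linarith [sq_nonneg (a - b), pow_le_pow_left₀ (add_nonneg ha hb) h' 2,
        add_sq a b, sub_sq a b]
    refine (prod_one_sub_pow_le_exp hν measureReal_le_one _ hsum).trans (le_of_eq ?_)
    simp only [Fintype.card_prod, Fintype.card_fin, Nat.cast_mul, div_div]
  · rintro ⟨i, j⟩ - ⟨i', j'⟩ - hne
    rw [Function.onFun, Finset.disjoint_left]
    intro e
    induction e with | _ x y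
    simp only [mem_crossPairs, partOf, Finset.mem_filter, Finset.mem_univ, true_and]
    intro h h'
    refine hne ?_
    rcases h with ⟨h1, h2⟩ | ⟨h1, h2⟩ <;> rw [h1, h2] at h' <;>
      simp only [Option.some.injEq, Sum.inl.injEq, Sum.inr.injEq, reduceCtorEq, and_self,
        or_false, false_or] at h' <;>
      rw [h'.1, h'.2]

/-- Union bound over all `(s + t + 1) ^ |V|` partial partitions of the vertex set. -/
theorem pi_real_isGraphMinor_le {V : Type*} [Fintype V] {s t : ℕ} (hs : 0 < s)
    (ht : 0 < t) (ν : Measure Bool) [IsProbabilityMeasure ν] (hν : 0 < ν.real {false}) :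
    (Measure.pi fun _ : Sym2 V => ν).real {ω |
      IsGraphMinor (completeBipartiteGraph (Fin s) (Fin t)) (graphOfIndicator ω)} ≤
    ((s + t + 1 : ℕ) : ℝ) ^ Fintype.card V *
    Real.exp (-(s * t * ν.real {false} ^ ((Fintype.card V : ℝ) ^ 2 / (4 * (s * t))))) := by
  classical
  have hsub : {ω : Sym2 V → Bool |
      IsGraphMinor (completeBipartiteGraph (Fin s) (Fin t)) (graphOfIndicator ω)} ⊆
      ⋃ g : V → Option (Fin s ⊕ Fin t),
        {ω | ∀ k ∈ (Finset.univ : Finset (Fin s × Fin t)),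
      ∃ e ∈ crossPairs (partOf g (Sum.inl k.1)) (partOf g (Sum.inr k.2)), ω e = true} := by
    rintro ω ⟨B, -, hdisj, hadj⟩
    refine Set.mem_iUnion.2
      ⟨fun v => if h : ∃ w, v ∈ B w then some h.choose else none, fun k _ => ?_⟩
    have hg : ∀ v w, v ∈ B w →
        v ∈ partOf (fun v => if h : ∃ w, v ∈ B w then some h.choose else none) w := by
      intro v w hv
      have hex : ∃ w, v ∈ B w := ⟨w, hv⟩
      simp only [partOf, Finset.mem_filter, Finset.mem_univ, true_and, dif_pos hex,
        Option.some.injEq]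
      by_contra hne
      exact Set.disjoint_left.1 (hdisj _ _ hne) hex.choose_spec hv
    obtain ⟨x, hx, y, hy, hxy⟩ := hadj (Sum.inl k.1) (Sum.inr k.2) (by simp)
    refine ⟨s(x, y), mem_crossPairs.2 (Or.inl ⟨hg x _ hx, hg y _ hy⟩), ?_⟩
    simpa [graphOfIndicator] using hxy.1
  refine (measureReal_mono hsub).trans ((measureReal_iUnion_fintype_le _).trans ?_)
  refine (Finset.sum_le_sum fun g _ => pi_real_partition_le hs ht ν hν g).trans (le_of_eq ?_)
  simp

/-- If the random graph rarely has `Q`, then some graph without `Q` has almost the expected number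
of edges: the graphs with `Q` contribute at most `η * |V|.choose 2` to the first moment. -/
theorem exists_edgeSet_ncard_ge {V : Type*} [Fintype V] (ν : Measure Bool)
    [IsProbabilityMeasure ν] (Q : SimpleGraph V → Prop) {η : ℝ}
    (hQ : (Measure.pi fun _ : Sym2 V => ν).real {ω | Q (graphOfIndicator ω)} < η)
    (hη : η < ν.real {true}) (hV : 2 ≤ Fintype.card V) :
    ∃ G : SimpleGraph V, ¬ Q G ∧
      (ν.real {true} - η) * ((Fintype.card V).choose 2 : ℕ) ≤ G.edgeSet.ncard := by
  classical
  set μ : Measure (Sym2 V → Bool) := Measure.pi fun _ => ν with hμ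
  set D : Finset (Sym2 V) := Finset.univ.filter fun e => ¬ e.IsDiag
  have hD : D.card = (Fintype.card V).choose 2 := by
    rw [← Sym2.card_subtype_not_diag, Fintype.card_subtype]
  have hcard : ∀ ω : Sym2 V → Bool, (((graphOfIndicator ω).edgeSet.ncard : ℕ) : ℝ) =
      ∑ e ∈ D, Set.indicator {ω : Sym2 V → Bool | ω e = true} (fun _ => (1 : ℝ)) ω := by
    intro ω
    have : (graphOfIndicator ω).edgeSet = ((D.filter fun e => ω e = true : Finset _) : Set _) := by
      ext e
      simp [graphOfIndicator, D, and_comm]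
    rw [this, Set.ncard_coe_finset, Finset.card_filter]
    push_cast
    exact Finset.sum_congr rfl fun e _ => by simp [Set.indicator_apply]
  have hmean : ∫ ω, (((graphOfIndicator ω).edgeSet.ncard : ℕ) : ℝ) ∂μ =
      ν.real {true} * D.card := by
    simp only [hcard]
    rw [integral_finsetSum _ fun e _ => .of_finite,
      Finset.sum_congr rfl (g := fun _ => ν.real {true}),
      Finset.sum_const, nsmul_eq_mul, mul_comm]
    intro e _
    rw [integral_indicator_const _ (Set.toFinite _).measurableSet, smul_eq_mul, mul_one]
    exact (measurePreserving_eval (fun _ : Sym2 V => ν) e).measureReal_preimage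
      (s := {true}) (MeasurableSet.singleton _).nullMeasurableSet
  by_contra! hcon
  have hpos : 0 < (ν.real {true} - η) * D.card := by
    rw [hD]
    exact mul_pos (sub_pos.2 hη) (by exact_mod_cast Nat.choose_pos hV)
  set A : Set (Sym2 V → Bool) := {ω | Q (graphOfIndicator ω)} with hA
  rw [← hD] at hcon
  have hle : ∫ ω, (((graphOfIndicator ω).edgeSet.ncard : ℕ) : ℝ) ∂μ ≤
      ∫ ω, (A.indicator (fun _ => (D.card : ℝ)) ω + (ν.real {true} - η) * D.card) ∂μ := by
    refine integral_mono .of_finite .of_finite fun ω => ?_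
    dsimp only
    by_cases hω : ω ∈ A
    · rw [Set.indicator_of_mem hω, hcard]
      refine le_trans ?_ (le_add_of_nonneg_right hpos.le)
      refine (Finset.sum_le_sum (g := fun _ => (1 : ℝ)) fun e _ =>
        Set.indicator_le_self' (fun _ _ => zero_le_one) ω).trans ?_
      simp
    · rw [Set.indicator_of_notMem hω, zero_add]
      exact (hcon _ hω).le
  rw [hmean, integral_add .of_finite .of_finite,
    integral_indicator_const _ (Set.toFinite _).measurableSet, integral_const, probReal_univ,
    smul_eq_mul, one_smul] at hle
  have hDpos : (0 : ℝ) < D.card := by rw [hD]; exact_mod_cast Nat.choose_pos hV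
  nlinarith [mul_lt_mul_of_pos_right hQ hDpos]

/-! ### Estimates for large `t` -/

/-- The union bound is below `δ`. The hypothesis `hlarge` compares `t ^ δ`, which comes from the
number of missing pairs, with `(log t) ^ 2`, which comes from the number of partial partitions. -/
theorem pow_mul_exp_lt {δ lam f : ℝ} {s t n : ℕ} (hδ0 : 0 < δ) (hδ1 : δ < 1) (hlam : 0 < lam)
    (hf : 1 ≤ f) (hft : f ≤ Real.log t) (ht : 3 ≤ (t : ℝ))
    (hst : (s : ℝ) ≤ t) (hs : (1 - δ) * (f * t) ≤ Real.log t * s) (hs0 : 0 < s)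
    (hn : (n : ℝ) ≤ 2 * (1 - δ) * (t * √f) / √lam)
    (hlarge : Real.log t ^ 2 * (-Real.log δ + 4 / √lam) < (1 - δ) * (t : ℝ) ^ δ) :
    ((s + t + 1 : ℕ) : ℝ) ^ n *
      Real.exp (-(s * t * Real.exp (-lam) ^ ((n : ℝ) ^ 2 / (4 * (s * t))))) < δ := by
  set x : ℝ := (t : ℝ)
  set L := Real.log x
  have hx : 0 < x := by linarith
  have hL : 1 ≤ L := hf.trans hft
  have hδ : 0 < 1 - δ := by linarith
  have hlog : Real.log δ < 0 := Real.log_neg hδ0 hδ1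
  have hs0' : (0 : ℝ) < s := by exact_mod_cast hs0
  have hr : 0 < √lam := Real.sqrt_pos.2 hlam
  have hfs : √f ≤ f := Real.sqrt_le_iff.2 ⟨by linarith, by nlinarith⟩
  -- The exponent `n² / (4 s t)` is at most `(1 - δ) log t / lam`.
  have hexp : (n : ℝ) ^ 2 / (4 * (s * x)) * lam ≤ (1 - δ) * L := by
    have h1 : (n : ℝ) ^ 2 * lam ≤ 4 * (1 - δ) ^ 2 * x ^ 2 * f := by
      have := pow_le_pow_left₀ (Nat.cast_nonneg n) hn 2
      rw [div_pow, le_div_iff₀ (by positivity), Real.sq_sqrt hlam.le] at this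
      calc (n : ℝ) ^ 2 * lam ≤ _ := this
        _ = 4 * (1 - δ) ^ 2 * x ^ 2 * √f ^ 2 := by ring
        _ = _ := by rw [Real.sq_sqrt (by linarith)]
    rw [div_mul_eq_mul_div, div_le_iff₀ (by positivity)]
    have h2 := mul_le_mul_of_nonneg_left hs (show 0 ≤ 4 * (1 - δ) * x by positivity)
    linarith
  have hq : Real.exp (-((1 - δ) * L)) ≤ Real.exp (-lam) ^ ((n : ℝ) ^ 2 / (4 * (s * x))) := by
    rw [← Real.exp_mul]
    exact Real.exp_le_exp.2 (by linarith)
  have hxe : x * Real.exp (-((1 - δ) * L)) = x ^ δ := by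
    nth_rw 1 [← Real.exp_log hx]
    rw [← Real.exp_add, Real.rpow_def_of_pos hx]
    congr 1; ring
  -- A lower bound for the expected number of missing pairs, of order `f t ^ (1 + δ) / log t`.
  have hmiss : (1 - δ) * (f * x) * x ^ δ / L ≤
      s * x * Real.exp (-lam) ^ ((n : ℝ) ^ 2 / (4 * (s * x))) := by
    calc (1 - δ) * (f * x) * x ^ δ / L ≤ L * s * x ^ δ / L := by gcongr
      _ = s * x * Real.exp (-((1 - δ) * L)) := by rw [mul_assoc (s : ℝ), hxe]; field_simp
      _ ≤ _ := by gcongr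
  -- There are at most `(s + t + 1) ^ n ≤ (t ^ 2) ^ n` partial partitions.
  have hcount : ((s + t + 1 : ℕ) : ℝ) ^ n ≤ Real.exp (4 * (f * x) * L / √lam) := by
    have h1 : ((s + t + 1 : ℕ) : ℝ) ≤ Real.exp (2 * L) := by
      rw [two_mul, Real.exp_add, Real.exp_log hx]
      push_cast
      nlinarith
    calc ((s + t + 1 : ℕ) : ℝ) ^ n ≤ Real.exp (2 * L) ^ n := by gcongr
      _ = Real.exp (n * (2 * L)) := (Real.exp_nat_mul _ _).symm
      _ ≤ _ := by
        refine Real.exp_le_exp.2 ?_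
        calc n * (2 * L) ≤ 2 * 1 * (x * f) / √lam * (2 * L) := by
              gcongr
              refine hn.trans ?_
              gcongr
              linarith
          _ = _ := by ring
  calc _ ≤ Real.exp (4 * (f * x) * L / √lam) *
        Real.exp (-((1 - δ) * (f * x) * x ^ δ / L)) := by gcongr
    _ = Real.exp (4 * (f * x) * L / √lam - (1 - δ) * (f * x) * x ^ δ / L) := by
        rw [← Real.exp_add, ← sub_eq_add_neg]
    _ < Real.exp (Real.log δ) := by
        refine Real.exp_lt_exp.2 ?_
        have h1 : f * x * L * (-Real.log δ + 4 / √lam) < (1 - δ) * (f * x) * x ^ δ / L := by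
          rw [lt_div_iff₀ (by linarith)]
          have := mul_lt_mul_of_pos_left hlarge (show 0 < f * x by positivity)
          linarith
        have h2 : -Real.log δ ≤ f * x * L * -Real.log δ :=
          le_mul_of_one_le_left (by linarith)
            (one_le_mul_of_one_le_of_one_le
              (one_le_mul_of_one_le_of_one_le hf (by linarith)) hL)
        have h3 : f * x * L * (4 / √lam) = 4 * (f * x) * L / √lam := by ring
        linarith
    _ = δ := Real.exp_log hδ0

theorem eventually_log_sq_mul_lt_rpow {δ : ℝ} (hδ0 : 0 < δ) (hδ1 : δ < 1) (C : ℝ) :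
    ∀ᶠ x : ℝ in Filter.atTop, Real.log x ^ 2 * C < (1 - δ) * x ^ δ := by
  have h := (isLittleO_log_rpow_rpow_atTop 2 hδ0).def
    (show 0 < (1 - δ) / (|C| + 1) from div_pos (by linarith) (by positivity))
  filter_upwards [h, Filter.eventually_gt_atTop 1] with x hx hx1
  have hL : 0 < Real.log x := Real.log_pos hx1
  rw [Real.rpow_two, Real.norm_of_nonneg (by positivity),
    Real.norm_of_nonneg (Real.rpow_nonneg (by linarith) _), div_mul_eq_mul_div,
    le_div_iff₀ (by positivity)] at hx
  nlinarith [le_abs_self C, sq_pos_of_pos hL]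

/-! ### The lower bound -/

theorem le_minorExtremal {W : Type*} {H : SimpleGraph W} {n : ℕ} (hn : 0 < n)
    {G : SimpleGraph (Fin n)} {c : ℝ} (hc : c ≤ edgeRatio G) (hG : ¬ IsGraphMinor H G) :
    (c : EReal) ≤ minorExtremal H := by
  refine le_sInf ?_
  rintro _ ⟨d, hd, rfl⟩
  rw [EReal.coe_le_coe_iff]
  by_contra! hlt
  exact hG (hd n hn G (hlt.le.trans hc))

theorem exists_near_minorAlpha {ε : ℝ} (hε : 0 < ε) : ∃ p : ℝ, 0 < p ∧ p < 1 ∧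
    minorAlpha - ε < p / (2 * √(Real.log (1 / (1 - p)))) := by
  obtain ⟨_, ⟨p, hp, rfl⟩, h⟩ := exists_lt_of_lt_csSup
    ((Set.nonempty_Ioo.2 (zero_lt_one' ℝ)).image
      fun p : ℝ => p / (2 * √(Real.log (1 / (1 - p)))))
    (show minorAlpha - ε < _ from sub_lt_self _ hε)
  exact ⟨p, hp.1, hp.2, h⟩

theorem exists_graph_of_large {p δ lam : ℝ} {s t n : ℕ} (hp1 : p < 1) (hδ0 : 0 < δ) (hδp : δ < p)
    (hlam : lam = Real.log (1 / (1 - p))) (hs0 : 0 < s) (hn2 : 2 ≤ n) (ht0 : 0 < t)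
    (hub : ((s + t + 1 : ℕ) : ℝ) ^ n *
      Real.exp (-(s * t * Real.exp (-lam) ^ ((n : ℝ) ^ 2 / (4 * (s * t))))) < δ) :
    ∃ G : SimpleGraph (Fin n), ¬ IsGraphMinor (completeBipartiteGraph (Fin s) (Fin t)) G ∧
      (p - δ) * (((n : ℝ) - 1) / 2) ≤ edgeRatio G := by
  have hq : 0 < 1 - p := by linarith
  have hp0 : 0 < p := hδ0.trans hδp
  set ν : Measure Bool := bernoulliMeasure true false ⟨p, hp0.le, hp1.le⟩
  have htrue : ν.real {true} = p := by
    simp [ν]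
  have hfalse : ν.real {false} = Real.exp (-lam) := by
    rw [hlam, one_div, Real.log_inv, neg_neg, Real.exp_log hq]
    simp [ν]
  have hbad := pi_real_isGraphMinor_le (V := Fin n) hs0 ht0 ν (by rw [hfalse]; positivity)
  rw [hfalse, Fintype.card_fin] at hbad
  obtain ⟨G, hG, hcard⟩ := exists_edgeSet_ncard_ge ν
    (fun G : SimpleGraph (Fin n) => IsGraphMinor (completeBipartiteGraph (Fin s) (Fin t)) G)
    (hbad.trans_lt hub) (by rwa [htrue]) (by simpa using hn2)
  refine ⟨G, hG, ?_⟩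
  have hn0 : (0 : ℝ) < n := by exact_mod_cast (show 0 < n by omega)
  rw [htrue, Fintype.card_fin, Nat.cast_choose_two] at hcard
  rw [edgeRatio, Nat.card_fin, le_div_iff₀ hn0]
  linarith

theorem theorem1p7 (ε : ℝ) (hε : 0 < ε) :
    ∃ T : ℝ, ∀ (t : ℕ) (f : ℝ), T < f → f ≤ Real.log (t : ℝ) →
      (∃ n : ℕ, 0 < n ∧ ∃ G : SimpleGraph (Fin n),
        (2 * minorAlpha - ε) * (t : ℝ) * Real.sqrt f ≤ edgeRatio G ∧
        ¬ IsGraphMinor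
          (completeBipartiteGraph (Fin ⌊f * (t : ℝ) / Real.log (t : ℝ)⌋₊) (Fin t)) G) ∧
      (((2 * minorAlpha - ε) * (t : ℝ) * Real.sqrt f : ℝ) : EReal) ≤
        minorExtremal
          (completeBipartiteGraph (Fin ⌊f * (t : ℝ) / Real.log (t : ℝ)⌋₊) (Fin t)) := by
  suffices h : ∃ T : ℝ, ∀ (t : ℕ) (f : ℝ), T < f → f ≤ Real.log (t : ℝ) →
      ∃ n : ℕ, 0 < n ∧ ∃ G : SimpleGraph (Fin n),
        (2 * minorAlpha - ε) * (t : ℝ) * Real.sqrt f ≤ edgeRatio G ∧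
        ¬ IsGraphMinor
          (completeBipartiteGraph (Fin ⌊f * (t : ℝ) / Real.log (t : ℝ)⌋₊) (Fin t)) G by
    obtain ⟨T, hT⟩ := h
    refine ⟨T, fun t f h1 h2 => ⟨hT t f h1 h2, ?_⟩⟩
    obtain ⟨n, hn, G, hG, hm⟩ := hT t f h1 h2
    exact le_minorExtremal hn hG hm
  obtain ⟨p, hp0, hp1, hpα⟩ := exists_near_minorAlpha (show 0 < ε / 4 by positivity)
  set lam := Real.log (1 / (1 - p)) with hlam
  have hlam0 : 0 < lam := Real.log_pos (by rw [lt_div_iff₀] <;> linarith)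
  have hr : 0 < √lam := Real.sqrt_pos.2 hlam0
  -- `δ` measures both the slack in the number of vertices and the probability of a minor.
  set δ := min (p / 2) (ε * √lam / 8) with hδ
  have hδ0 : 0 < δ := lt_min (by positivity) (by positivity)
  have hδp : δ < p := (min_le_left _ _).trans_lt (by linarith)
  have hδε : δ ≤ ε * √lam / 8 := min_le_right _ _
  have hδ1 : 0 < 1 - δ := by linarith
  obtain ⟨x₀, hx₀⟩ := Filter.eventually_atTop.1
    (((eventually_log_sq_mul_lt_rpow hδ0 (by linarith) (-Real.log δ + 4 / √lam)).and
      (Real.isLittleO_log_id_atTop.def hδ0)).and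
      ((Filter.eventually_ge_atTop (4 * p / ε)).and
        (Filter.eventually_ge_atTop (√lam / (1 - δ)))))
  -- As `T < f ≤ log t`, a large `T` forces `t` to be large.
  refine ⟨max 1 (Real.log (max 3 x₀)), fun t f hTf hft => ?_⟩
  have hf : 1 ≤ f := (le_max_left _ _).trans hTf.le
  have ht0 : 0 < (t : ℝ) := by
    rcases (Nat.cast_nonneg t : (0 : ℝ) ≤ t).eq_or_lt with h | h
    · rw [← h, Real.log_zero] at hft; linarith
    · exact h
  have htx : max 3 x₀ < (t : ℝ) :=
    (Real.log_lt_log_iff (by positivity) ht0).1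
      (((le_max_right _ _).trans_lt hTf).trans_le hft)
  have ht3 : 3 ≤ (t : ℝ) := (le_max_left _ _).trans htx.le
  obtain ⟨⟨hlarge, hlogt⟩, htp, htn⟩ := hx₀ t ((le_max_right _ _).trans htx.le)
  have hL : 1 ≤ Real.log t := hf.trans hft
  rw [Real.norm_of_nonneg (by linarith), id, Real.norm_of_nonneg ht0.le] at hlogt
  set s := ⌊f * (t : ℝ) / Real.log (t : ℝ)⌋₊ with hs
  have hsle : (s : ℝ) ≤ t :=
    (Nat.floor_le (by positivity)).trans ((div_le_iff₀ (by linarith)).2 (by nlinarith))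
  -- Rounding down loses at most the factor `1 - δ`, because `log t ≤ δ * t`.
  have hsge : (1 - δ) * (f * t) ≤ Real.log t * s := by
    have h := (Nat.lt_floor_add_one (f * (t : ℝ) / Real.log (t : ℝ))).le
    rw [← hs, div_le_iff₀ (by linarith)] at h
    nlinarith [mul_le_mul_of_nonneg_right hf (mul_pos hδ0 ht0).le]
  have hs0 : 0 < s := by
    rcases Nat.eq_zero_or_pos s with h | h
    · rw [h, Nat.cast_zero, mul_zero] at hsge
      exact absurd hsge (not_le.2 (by positivity))
    · exact h
  set X := (t : ℝ) * √f with hX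
  have htX : (t : ℝ) ≤ X := le_mul_of_one_le_right ht0.le (Real.one_le_sqrt.2 hf)
  set n := ⌊2 * (1 - δ) * X / √lam⌋₊ with hn
  have hnle : (n : ℝ) ≤ 2 * (1 - δ) * X / √lam := Nat.floor_le (by positivity)
  have hnge := (Nat.lt_floor_add_one (2 * (1 - δ) * X / √lam)).le
  rw [← hn] at hnge
  have hn2 : 2 ≤ n := by
    refine Nat.le_floor ?_
    rw [div_le_iff₀ hδ1] at htn
    rw [le_div_iff₀ hr]
    push_cast
    nlinarith
  obtain ⟨G, hG, hratio⟩ := exists_graph_of_large hp1 hδ0 hδp hlam hs0 hn2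
    (by exact_mod_cast ht0)
    (pow_mul_exp_lt hδ0 (by linarith) hlam0 hf hft ht3 hsle hsge hs0 hnle hlarge)
  refine ⟨n, by omega, G, ?_, hG⟩
  refine le_trans ?_ hratio
  have hX0 : 0 < X := ht0.trans_le htX
  have h1 : p ≤ ε / 4 * X := by
    rw [div_le_iff₀ hε] at htp
    nlinarith
  have h2 : (2 * minorAlpha - ε) * X ≤ (p / √lam - ε / 2) * X := by
    refine mul_le_mul_of_nonneg_right ?_ hX0.le
    have : p / (2 * √lam) * 2 = p / √lam := by field_simp
    linarith
  have h3 : (p / √lam - ε / 4) * X ≤ (p - δ) * ((1 - δ) * X / √lam) := by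
    have : p / √lam - ε / 4 ≤ (p - δ) * (1 - δ) / √lam := by
      rw [le_div_iff₀ hr, sub_mul, div_mul_cancel₀ _ hr.ne']
      nlinarith
    calc _ ≤ (p - δ) * (1 - δ) / √lam * X := mul_le_mul_of_nonneg_right this hX0.le
      _ = _ := by ring
  have h4 : (p - δ) * ((1 - δ) * X / √lam - 1) ≤ (p - δ) * (((n : ℝ) - 1) / 2) := by
    refine mul_le_mul_of_nonneg_left ?_ (by linarith)
    have : 2 * (1 - δ) * X / √lam = 2 * ((1 - δ) * X / √lam) := by ring
    linarith
  rw [mul_assoc, ← hX]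
  linarith
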